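/- All algebras are complex, commutative and unital with $\|1\|=1$, and homomorphisms are unital. For a normed algebra $A$, let $\Omega(A)$ be the set of non-zero continuous complex homomorphisms $A\to\mathbb C$ with the weak-* topology. Let $A$ be a normed algebra (not necessarily complete) and $\mathcal U\subseteq A[x]$ a non-empty well-ordered set of monic polynomials, with least element $\alpha_0$. A *standard extension* of $A$ relative to $\mathcal U$ is an algebra $B\supseteq A$ with intermediate subalgebras $A\subseteq B_\alpha\subseteq B$ $(\alpha\in\mathcal U)$ such that $B=\bigcup_\alpha B_\alpha$, $B_\alpha\subseteq B_\beta$ whenever $\alpha\le\beta$, and for each $\alpha$ an isomorphism $\varphi_\alpha\colon B_\alpha\to A_\alpha[x]/(\alpha(x))$ which restricts to the canonical embedding on $A_\alpha$, where $A_{\alpha_0}=A$ and $A_\alpha=\bigcup_{\beta<\alpha}B_\beta$ for $\alpha>\alpha_0$. It is a *standard normed extension* (a generalised Arens–Hoffman extension) if $B$ is a normed algebra whose norm extends that of $A$ and, for each $\alpha=a_0+\dots+a_{n-1}x^{n-1}+x^n\in\mathcal U$, there is $t>0$ with $\sum_{k<n}\|a_k\|t^k\le t^n$ such that $\varphi_\alpha$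 is isometric when $A_\alpha$ and $B_\alpha$ carry the norm of $B$ and $A_\alpha[x]/(\alpha(x))$ carries the quotient norm induced by $\bigl\|\sum_k c_kx^k\bigr\|=\sum_k\|c_k\|t^k$ on $A_\alpha[x]$. **Theorem 5.6 and Corollary 5.7.** Let $B$ be a standard normed extension of $A$ relative to $\mathcal U$, and let $\xi_\alpha=\varphi_\alpha^{-1}(\bar x)$, where $\bar x$ is the coset of $x$. Then $$H\longmapsto\bigl(H|_A,\,(H(\xi_\alpha))_{\alpha\in\mathcal U}\bigr)$$ is a homeomorphism from $\Omega(B)$ onto $$\{(h,\lambda)\in\Omega(A)\times\mathbb C^{\mathcal U} : h(\alpha)(\lambda_\alpha)=0\text{ for all }\alpha\in\mathcal U\},$$ a subspace of the product $\Omega(A)\times\mathbb C^{\mathcal U}$; here $h(\alpha)\in\mathbb C[x]$ is obtained by applying $h$ to the coefficients of $\alpha$. Consequently the restriction maps $\Omega(B)\to\Omega(A)$, $H\mapsto H|_A$, and $\Omega(B)\to\Omega(B_\alpha)$, $H\mapsto H|_{B_\alpha}$ $(\alpha\in\mathcal U)$, are surjective. -/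

import Mathlib

open Polynomial WeakDual

namespace ArensHoffman

/-! ### The Arens-Hoffman norm on `R[x] / (f)` -/

section Norm

variable {R : Type*} [NormedCommRing R]

/-- The norm `‖∑ c_k x^k‖ = ∑ ‖c_k‖ t^k` on `R[x]` with parameter `t`. -/
noncomputable def polyNorm (t : ℝ) (p : R[X]) : ℝ :=
  p.sum fun k c => ‖c‖ * t ^ k

/-- `t` is an admissible parameter for the monic polynomial
`f = a_0 + ⋯ + a_{n-1} x^{n-1} + x^n`:
`t > 0` and `‖a_0‖ + ‖a_1‖ t + ⋯ + ‖a_{n-1}‖ t^{n-1} ≤ t^n`. -/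
def IsParameter (f : R[X]) (t : ℝ) : Prop :=
  0 < t ∧ ∑ k ∈ Finset.range f.natDegree, ‖f.coeff k‖ * t ^ k ≤ t ^ f.natDegree

/-- The Arens-Hoffman (quotient) norm with parameter `t` on `R[x] / (f)`: the infimum of the norms
`polyNorm t p` over all representatives `p` of the coset `q`. -/
noncomputable def quotNorm (f : R[X]) (t : ℝ) (q : AdjoinRoot f) : ℝ :=
  ⨅ p : {p : R[X] // AdjoinRoot.mk f p = q}, polyNorm t (p : R[X])

end Norm

/-! ### Standard extensions -/

section Algebraic

variable {A B : Type*} [CommRing A] [CommRing B] [Algebra A B] {U : Set A[X]} [LinearOrder U]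

/-- For a family `(B_α)` of intermediate subalgebras, the subalgebra `A_α` of `B` generated over `A`
by the `B_β` with `β < α`. For a monotone family it is the union of these `B_β` when
`α` is not the least element, and it is (the image in `B` of) `A` when `α` is the least element;
see `lower_of_isMin` and `coe_lower_of_not_isMin`. -/
def lower (S : U → Subalgebra A B) (α : U) : Subalgebra A B :=
  ⨆ β : Set.Iio α, S β

theorem lower_of_isMin (S : U → Subalgebra A B) {α : U} (hα : IsMin α) : lower S α = ⊥ := by
  have : IsEmpty (Set.Iio α) := ⟨fun β => hα.not_lt β.2⟩
  exact iSup_of_empty _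

theorem coe_lower_of_not_isMin {S : U → Subalgebra A B} (hS : Monotone S) {α : U}
    (hα : ¬ IsMin α) : (lower S α : Set B) = ⋃ β : Set.Iio α, (S β : Set B) := by
  obtain ⟨β, hβ⟩ := not_isMin_iff.1 hα
  have : Nonempty (Set.Iio α) := ⟨⟨β, hβ⟩⟩
  exact Subalgebra.coe_iSup_of_directed
    (Monotone.directed_le (f := fun β : Set.Iio α => S β) fun _ _ h => hS h)

theorem lower_le {S : U → Subalgebra A B} (hS : Monotone S) (α : U) : lower S α ≤ S α :=
  iSup_le fun β => hS (le_of_lt β.2)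

/-- The polynomial `α ∈ U` regarded as a polynomial over `A_α`. -/
noncomputable def lowerPoly (S : U → Subalgebra A B) (α : U) : (lower S α)[X] :=
  (α : A[X]).map (algebraMap A (lower S α))

variable (A B U) in
/-- `B` is a standard extension of `A` relative to a well-ordered set `U` of monic polynomials over
`A`: an increasing family `(B_α)` of intermediate subalgebras with union `B`, and for each
`α ∈ U` an isomorphism `φ_α : B_α ≅ A_α[x] / (α(x))` over `A_α`. -/
structure StandardExtension [WellFoundedLT U] where
  /-- `B` is an extension of `A`. -/
  injective : Function.Injective (algebraMap A B)
  /-- The intermediate subalgebra `B_α`. -/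
  sub : U → Subalgebra A B
  mono : Monotone sub
  iUnion_sub : ⋃ α, (sub α : Set B) = Set.univ
  /-- The isomorphism `φ_α`. -/
  iso : ∀ α : U, sub α ≃+* AdjoinRoot (lowerPoly sub α)
  /-- `φ_α` restricts to the canonical embedding of `A_α` in `A_α[x] / (α(x))`. -/
  iso_lower : ∀ (α : U) (a : lower sub α),
    iso α (Subalgebra.inclusion (lower_le mono α) a) = AdjoinRoot.of (lowerPoly sub α) a

/-- The root `ξ_α` of `α` in `B_α ⊆ B`: the element with `φ_α(ξ_α)` the coset of `x`. -/
noncomputable def StandardExtension.root [WellFoundedLT U] (E : StandardExtension A B U) (α : U) :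
    B :=
  ((E.iso α).symm (AdjoinRoot.root (lowerPoly E.sub α)) : E.sub α)

end Algebraic

/-! ### Standard normed extensions and restriction of characters -/

section Normed

variable {A B : Type*} [NormedCommRing A] [NormedAlgebra ℂ A]
  [NormedCommRing B] [NormedAlgebra ℂ B] [Algebra A B] [IsScalarTower ℂ A B]
  {U : Set A[X]} [LinearOrder U] [WellFoundedLT U]

/-- The norm of `B` makes the standard extension `B` of `A` a standard normed extension
(a generalised Arens-Hoffman extension): it extends the norm of `A`, and for each `α` there is an
admissible parameter for which `φ_α` is isometric, where `A_α[x] / (α(x))` has the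
corresponding Arens-Hoffman norm and `A_α`, `B_α` have the norm of `B`. -/
def StandardExtension.IsNormed (E : StandardExtension A B U) : Prop :=
  (∀ a : A, ‖algebraMap A B a‖ = ‖a‖) ∧
    ∀ α : U, ∃ t : ℝ, IsParameter (lowerPoly E.sub α) t ∧
      ∀ b : E.sub α, quotNorm (lowerPoly E.sub α) t (E.iso α b) = ‖(b : B)‖

/-- The restriction `H ↦ H ∘ f` of continuous characters along a continuous unital
homomorphism `f`. -/
noncomputable def charComp {C D : Type*} [Ring C] [TopologicalSpace C] [Algebra ℂ C]
    [Ring D] [TopologicalSpace D] [Algebra ℂ D]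
    (f : C →ₐ[ℂ] D) (hf : Continuous f) (H : characterSpace ℂ D) : characterSpace ℂ C :=
  ⟨StrongDual.toWeakDual
      ((WeakDual.toStrongDual (H : WeakDual ℂ D)).comp ⟨f.toLinearMap, hf⟩), by
    refine ⟨fun h0 => ?_, fun x y => ?_⟩
    · have h1 : H (f 1) = 0 := DFunLike.congr_fun h0 (1 : C)
      rw [map_one, map_one] at h1
      exact one_ne_zero h1
    · change H (f (x * y)) = H (f x) * H (f y)
      rw [map_mul, map_mul]⟩

theorem charComp_apply {C D : Type*} [Ring C] [TopologicalSpace C] [Algebra ℂ C]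
    [Ring D] [TopologicalSpace D] [Algebra ℂ D]
    (f : C →ₐ[ℂ] D) (hf : Continuous f) (H : characterSpace ℂ D) (c : C) :
    charComp f hf H c = H (f c) := rfl

theorem StandardExtension.IsNormed.continuous {E : StandardExtension A B U} (hE : E.IsNormed) :
    Continuous (IsScalarTower.toAlgHom ℂ A B) :=
  (AddMonoidHomClass.isometry_of_norm (IsScalarTower.toAlgHom ℂ A B) hE.1).continuous

/-- The restriction map `Ω(B) → Ω(A)`, `H ↦ H|_A`. -/
noncomputable def StandardExtension.restrictBase (E : StandardExtension A B U) (hE : E.IsNormed) :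
    characterSpace ℂ B → characterSpace ℂ A :=
  charComp (IsScalarTower.toAlgHom ℂ A B) hE.continuous

/-- The restriction map `Ω(B) → Ω(B_α)`, `H ↦ H|_{B_α}`. -/
noncomputable def StandardExtension.restrictSub (E : StandardExtension A B U) (α : U) :
    characterSpace ℂ B → characterSpace ℂ (E.sub α) :=
  charComp ((E.sub α).val.restrictScalars ℂ) continuous_subtype_val

end Normed

/-- The set of all `(h, z) ∈ Ω(A) × ℂ^U` with `h(α)(z_α) = 0` for all `α ∈ U`, where `h(α)` is the
complex polynomial obtained by applying `h` to the coefficients of `α`. -/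
def rootSet {A : Type*} [NormedCommRing A] [NormedAlgebra ℂ A] (U : Set A[X]) :
    Set (characterSpace ℂ A × (U → ℂ)) :=
  {p | ∀ α : U, ((α : A[X]).map (CharacterSpace.toAlgHom p.1 : A →+* ℂ)).eval (p.2 α) = 0}

end ArensHoffman

/-!
Write `ξ_α` for the root of `α` in `B`. Because `B_α ≅ A_α[x] / (α(x))`, well-founded induction shows
that `B_α` is generated as an `A`-algebra by the roots `ξ_β` with `β ≤ α` (`sub_le_adjoin`), and
hence that `B` is generated by all the roots (`adjoin_range_root`). So a character of `B` is
determined by its restriction to `A` and its values at the roots, and the pointwise values of a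
character depend continuously on these data: the elements of `B` at which they do form a subalgebra
containing `A` and the roots.

It remains to show that every `(h, z)` in `rootSet U` comes from a character of `B`. The algebra `A`
need not be complete, so continuity of the extension has to be secured along the construction, by
keeping it contractive. A continuous character is contractive (`norm_character_apply_le`). If `g` is
a contractive character of `A_α` and `z` is a root of `g(α)`, then the parameter inequality for `t`
forces `‖z‖ ≤ t` (`norm_le_of_isParameter`), so `‖g(p)(z)‖ ≤ polyNorm t p` for every polynomial `p`;
taking the infimum over a coset, the induced character of `A_α[x] / (α(x)) ≅ B_α` is again
contractive (`exists_extend_sub`). At limit stages the characters already constructed are compatible,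
since they agree on generators, and can be glued (`exists_glue`).

The restriction maps are then onto because each `h(α)` is a complex polynomial of positive degree
(otherwise `B_α` would be the zero ring), so that prescribed roots can be completed to a full family.
-/

namespace ArensHoffman

/-! ### Estimates for characters -/

/-- A continuous character of a normed algebra, complete or not, is contractive. -/
theorem norm_character_apply_le {C : Type*} [NormedCommRing C] [NormedAlgebra ℂ C]
    (φ : characterSpace ℂ C) (c : C) : ‖φ c‖ ≤ ‖c‖ := by
  by_contra! hlt
  obtain ⟨K, hK, hφ⟩ := (WeakDual.toStrongDual (φ : WeakDual ℂ C)).bound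
  have hc : 0 < ‖c‖ := by
    refine norm_pos_iff.2 fun h0 => ?_
    rw [h0, map_zero] at hlt
    simp at hlt
  obtain ⟨n, hn⟩ := pow_unbounded_of_one_lt K ((one_lt_div hc).2 hlt)
  -- The power `n + 1` is positive, so `‖c ^ (n + 1)‖ ≤ ‖c‖ ^ (n + 1)` without `‖1‖ = 1`.
  have h1 : ‖φ c‖ ^ (n + 1) ≤ K * ‖c‖ ^ (n + 1) := by
    have h2 : ‖φ (c ^ (n + 1))‖ ≤ K * ‖c ^ (n + 1)‖ := hφ _
    rw [map_pow, norm_pow] at h2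
    exact h2.trans (mul_le_mul_of_nonneg_left (norm_pow_le' c n.succ_pos) hK.le)
  have h3 : (‖φ c‖ / ‖c‖) ^ (n + 1) ≤ K := by
    rw [div_pow]
    exact (div_le_iff₀ (pow_pos hc _)).2 h1
  exact (hn.trans_le
    (pow_le_pow_right₀ ((one_lt_div hc).2 hlt).le n.le_succ)).not_ge h3

/-- A root of the image of `f` under a contractive homomorphism is bounded by every admissible
parameter for `f`. -/
theorem norm_le_of_isParameter {R : Type*} [NormedCommRing R] {f : R[X]} {t : ℝ}
    (ht : IsParameter f t) (hf : f.Monic) (hdeg : f.natDegree ≠ 0) (g : R →+* ℂ)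
    (hg : ∀ r, ‖g r‖ ≤ ‖r‖) {z : ℂ} (hz : f.eval₂ g z = 0) : ‖z‖ ≤ t := by
  obtain ⟨ht0, hsum⟩ := ht
  by_contra! hlt
  obtain ⟨n, hn⟩ := Nat.exists_eq_succ_of_ne_zero hdeg
  rw [hn] at hsum
  rw [eval₂_eq_sum_range, Finset.sum_range_succ, hf.coeff_natDegree, map_one, one_mul, hn] at hz
  have hpow : ‖z‖ ^ (n + 1) ≤ ∑ k ∈ Finset.range (n + 1), ‖f.coeff k‖ * ‖z‖ ^ k := by
    rw [← norm_pow, eq_neg_of_add_eq_zero_right hz, norm_neg]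
    refine (norm_sum_le _ _).trans (Finset.sum_le_sum fun k _ => ?_)
    rw [norm_mul, norm_pow]
    exact mul_le_mul_of_nonneg_right (hg _) (by positivity)
  -- Comparing `‖z‖ ^ k * t ^ n` with `t ^ k * ‖z‖ ^ n` for `k ≤ n` gives
  -- `‖z‖ ^ (n + 1) * t ^ n ≤ t ^ (n + 1) * ‖z‖ ^ n`, that is, `‖z‖ ≤ t`.
  have hcmp : (∑ k ∈ Finset.range (n + 1), ‖f.coeff k‖ * ‖z‖ ^ k) * t ^ n ≤
      (∑ k ∈ Finset.range (n + 1), ‖f.coeff k‖ * t ^ k) * ‖z‖ ^ n := by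
    rw [Finset.sum_mul, Finset.sum_mul]
    refine Finset.sum_le_sum fun k hk => ?_
    obtain ⟨m, rfl⟩ := Nat.exists_eq_add_of_le (Nat.lt_succ_iff.1 (Finset.mem_range.1 hk))
    have hm : t ^ m ≤ ‖z‖ ^ m := pow_le_pow_left₀ ht0.le hlt.le m
    calc ‖f.coeff k‖ * ‖z‖ ^ k * t ^ (k + m)
        = ‖f.coeff k‖ * ‖z‖ ^ k * t ^ k * t ^ m := by ring
      _ ≤ ‖f.coeff k‖ * ‖z‖ ^ k * t ^ k * ‖z‖ ^ m := by gcongr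
      _ = ‖f.coeff k‖ * t ^ k * ‖z‖ ^ (k + m) := by ring
  have hz0 : 0 < ‖z‖ := ht0.trans hlt
  have h1 : ‖z‖ ^ (n + 1) * t ^ n ≤ t ^ (n + 1) * ‖z‖ ^ n :=
    calc ‖z‖ ^ (n + 1) * t ^ n
        ≤ (∑ k ∈ Finset.range (n + 1), ‖f.coeff k‖ * ‖z‖ ^ k) * t ^ n := by gcongr
      _ ≤ (∑ k ∈ Finset.range (n + 1), ‖f.coeff k‖ * t ^ k) * ‖z‖ ^ n := hcmp
      _ ≤ t ^ (n + 1) * ‖z‖ ^ n := by gcongr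
  have h2 : ‖z‖ * (‖z‖ ^ n * t ^ n) ≤ t * (‖z‖ ^ n * t ^ n) := by
    convert h1 using 1 <;> ring
  exact hlt.not_ge (le_of_mul_le_mul_right h2 (by positivity))

theorem norm_eval₂_le_polyNorm {R : Type*} [NormedCommRing R] (g : R →+* ℂ)
    (hg : ∀ r, ‖g r‖ ≤ ‖r‖) {z : ℂ} {t : ℝ} (hz : ‖z‖ ≤ t) (p : R[X]) :
    ‖p.eval₂ g z‖ ≤ polyNorm t p := by
  rw [eval₂_def, polyNorm, Polynomial.sum, Polynomial.sum]
  refine (norm_sum_le _ _).trans (Finset.sum_le_sum fun k _ => ?_)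
  rw [norm_mul, norm_pow]
  have := hg (p.coeff k)
  gcongr

theorem norm_lift_le_quotNorm {R : Type*} [NormedCommRing R] {f : R[X]} (g : R →+* ℂ)
    (hg : ∀ r, ‖g r‖ ≤ ‖r‖) {z : ℂ} {t : ℝ} (hz : ‖z‖ ≤ t) (hf : f.eval₂ g z = 0)
    (q : AdjoinRoot f) : ‖AdjoinRoot.lift g z hf q‖ ≤ quotNorm f t q := by
  obtain ⟨p, hp⟩ := AdjoinRoot.mk_surjective q
  have : Nonempty {p : R[X] // AdjoinRoot.mk f p = q} := ⟨⟨p, hp⟩⟩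
  refine le_ciInf fun ⟨p, hp⟩ => ?_
  subst hp
  rw [AdjoinRoot.lift_mk]
  exact norm_eval₂_le_polyNorm g hg hz p

/-- The character given by a contractive unital homomorphism. -/
noncomputable def characterOfContractive {C : Type*} [NormedCommRing C] [NormedAlgebra ℂ C]
    (f : C →ₐ[ℂ] ℂ) (hf : ∀ c, ‖f c‖ ≤ ‖c‖) : characterSpace ℂ C :=
  ⟨StrongDual.toWeakDual (f.toLinearMap.mkContinuous 1 fun c => by simpa using hf c), by
    refine ⟨fun h0 => ?_, map_mul f⟩
    have h1 : f 1 = 0 := DFunLike.congr_fun h0 (1 : C)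
    rw [map_one] at h1
    exact one_ne_zero h1⟩

theorem continuous_character_eval {C : Type*} [NormedCommRing C] [NormedAlgebra ℂ C] (c : C) :
    Continuous fun H : characterSpace ℂ C => H c :=
  (WeakDual.eval_continuous c).comp continuous_subtype_val

theorem continuous_into_characterSpace {X C : Type*} [TopologicalSpace X] [NormedCommRing C]
    [NormedAlgebra ℂ C] {F : X → characterSpace ℂ C} (hF : ∀ c, Continuous fun x => F x c) :
    Continuous F :=
  Continuous.subtype_mk (WeakDual.continuous_of_continuous_eval hF) _

/-! ### Generation by the roots -/

section Algebraic

variable {A B : Type*} [CommRing A] [CommRing B] [Algebra A B] {U : Set A[X]} [LinearOrder U]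

theorem lowerPoly_eval₂ {K : Type*} [CommRing K] [Algebra A K] (S : U → Subalgebra A B) (α : U)
    (g : lower S α →ₐ[A] K) (z : K) :
    (lowerPoly S α).eval₂ (g : lower S α →+* K) z = (α : A[X]).eval₂ (algebraMap A K) z := by
  rw [lowerPoly, eval₂_map, AlgHom.comp_algebraMap]

variable [WellFoundedLT U] (E : StandardExtension A B U)

namespace StandardExtension

theorem root_mem_sub (α : U) : E.root α ∈ E.sub α := Subtype.property _

theorem root_mem_sub_of_le {α β : U} (h : β ≤ α) : E.root β ∈ E.sub α :=
  E.mono h (E.root_mem_sub β)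

theorem iso_root (α : U) :
    E.iso α ⟨E.root α, E.root_mem_sub α⟩ = AdjoinRoot.root (lowerPoly E.sub α) :=
  (E.iso α).apply_symm_apply _

theorem aeval_root_eq_zero (α : U) :
    aeval (E.root α) (α : A[X]) = 0 := by
  have h1 : E.iso α (aeval (⟨E.root α, E.root_mem_sub α⟩ : E.sub α) (α : A[X])) = 0 := by
    have hc : (E.iso α : E.sub α →+* _).comp (algebraMap A (E.sub α)) =
        (AdjoinRoot.of (lowerPoly E.sub α)).comp (algebraMap A (lower E.sub α)) :=
      RingHom.ext fun a => E.iso_lower α (algebraMap A _ a)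
    rw [aeval_def, ← RingEquiv.coe_toRingHom, hom_eval₂, hc, ← eval₂_map, RingEquiv.coe_toRingHom,
      E.iso_root]
    exact AdjoinRoot.eval₂_root _
  have h2 := (map_eq_zero_iff (E.iso α) (E.iso α).injective).1 h1
  have h3 := congrArg (E.sub α).val h2
  rwa [map_zero, ← aeval_algHom_apply] at h3

/-- `B_α` is generated by `ξ_α` over `A_α`. -/
theorem exists_aeval_root (α : U) {b : B} (hb : b ∈ E.sub α) :
    ∃ p : (lower E.sub α)[X], b = aeval (E.root α) p := by
  obtain ⟨p, hp⟩ := AdjoinRoot.mk_surjective (E.iso α ⟨b, hb⟩)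
  refine ⟨p, ?_⟩
  have key : ((E.iso α).symm : _ →+* E.sub α).comp (AdjoinRoot.mk (lowerPoly E.sub α)) =
      eval₂RingHom (Subalgebra.inclusion (lower_le E.mono α) : _ →+* E.sub α)
        ⟨E.root α, E.root_mem_sub α⟩ := by
    refine Polynomial.ringHom_ext (fun a => ?_) ?_
    · have h := (E.iso α).symm_apply_apply (Subalgebra.inclusion (lower_le E.mono α) a)
      rw [E.iso_lower] at h
      simpa using h
    · simp [root]
  have h1 := DFunLike.congr_fun key p
  have h2 : (E.iso α).symm (AdjoinRoot.mk (lowerPoly E.sub α) p) = ⟨b, hb⟩ := by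
    rw [hp, RingEquiv.symm_apply_apply]
  have h3 := h2.symm.trans h1
  have h4 := congrArg (E.sub α).val h3
  rw [coe_eval₂RingHom, ← AlgHom.coe_toRingHom, hom_eval₂] at h4
  exact h4

theorem sub_le_adjoin (α : U) : E.sub α ≤ Algebra.adjoin A (E.root '' Set.Iic α) := by
  induction α using WellFoundedLT.induction with
  | ind α ih =>
    have hlow : lower E.sub α ≤ Algebra.adjoin A (E.root '' Set.Iic α) :=
      iSup_le fun β => (ih β β.2).trans
        (Algebra.adjoin_mono (Set.image_mono (Set.Iic_subset_Iic.2 (le_of_lt β.2))))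
    intro b hb
    obtain ⟨p, rfl⟩ := E.exists_aeval_root α hb
    rw [aeval_eq_sum_range]
    refine sum_mem fun k _ => ?_
    rw [Algebra.smul_def]
    exact mul_mem (hlow (p.coeff k).2)
      (pow_mem (Algebra.subset_adjoin (Set.mem_image_of_mem _ Set.self_mem_Iic)) k)

theorem exists_mem_sub (b : B) : ∃ α, b ∈ E.sub α :=
  Set.mem_iUnion.1 (E.iUnion_sub.symm ▸ Set.mem_univ b)

theorem adjoin_range_root : Algebra.adjoin A (Set.range E.root) = ⊤ := by
  refine eq_top_iff.2 fun b _ => ?_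
  obtain ⟨α, hα⟩ := E.exists_mem_sub b
  exact Algebra.adjoin_mono (Set.image_subset_range _ _) (E.sub_le_adjoin α hα)

theorem sub_algHom_ext {K : Type*} [CommRing K] [Algebra A K] {α : U} {f g : E.sub α →ₐ[A] K}
    (h : ∀ β, ∀ hβ : β ≤ α,
      f ⟨E.root β, E.root_mem_sub_of_le hβ⟩ = g ⟨E.root β, E.root_mem_sub_of_le hβ⟩) :
    f = g := by
  have hle : E.sub α ≤ (AlgHom.equalizer f g).map (E.sub α).val := by
    refine (E.sub_le_adjoin α).trans (Algebra.adjoin_le ?_)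
    rintro _ ⟨β, hβ, rfl⟩
    exact ⟨⟨E.root β, E.root_mem_sub_of_le hβ⟩, h β hβ, rfl⟩
  ext x
  obtain ⟨y, hy, hyx⟩ := hle x.2
  rwa [← Subtype.ext hyx]

/-- Homomorphisms on the `B_α` with the prescribed values at the roots are compatible. -/
theorem eq_comp_inclusion {E : StandardExtension A B U} {K : Type*} [CommRing K] [Algebra A K]
    {z : U → K} {α β : U}
    (h : α ≤ β) {f : E.sub α →ₐ[A] K} {g : E.sub β →ₐ[A] K}
    (hf : ∀ γ, ∀ hγ : γ ≤ α, f ⟨E.root γ, E.root_mem_sub_of_le hγ⟩ = z γ)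
    (hg : ∀ γ, ∀ hγ : γ ≤ β, g ⟨E.root γ, E.root_mem_sub_of_le hγ⟩ = z γ) :
    f = g.comp (Subalgebra.inclusion (E.mono h)) :=
  E.sub_algHom_ext fun γ hγ => (hf γ hγ).trans (hg γ (hγ.trans h)).symm

/-- If `α` were constant, hence `1`, then `B_α` would be the zero ring. -/
theorem natDegree_ne_zero (E : StandardExtension A B U) [Nontrivial A] {α : U} (hα : (α : A[X]).Monic) :
    (α : A[X]).natDegree ≠ 0 := by
  intro h0
  have h1 : lowerPoly E.sub α = 1 := by
    rw [lowerPoly, hα.natDegree_eq_zero.1 h0, Polynomial.map_one]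
  have hz : (1 : AdjoinRoot (lowerPoly E.sub α)) = 0 := by
    rw [← map_one (AdjoinRoot.mk _), AdjoinRoot.mk_eq_zero, h1]
  have hB : (1 : E.sub α) = 0 := (E.iso α).injective (by rw [map_one, map_zero, hz])
  have : (1 : A) = 0 := E.injective (by
    rw [map_one, map_zero]
    exact congrArg Subtype.val hB)
  exact one_ne_zero this

end StandardExtension

/-- Compatible homomorphisms on the members of an increasing family of subalgebras extend to
their union. -/
theorem exists_glue {K ι : Type*} [CommRing K] [Algebra A K] [LinearOrder ι] [Nonempty ι]
    {S : ι → Subalgebra A B} (hS : Monotone S) (f : ∀ i, S i →ₐ[A] K)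
    (hf : ∀ i j, ∀ h : i ≤ j, f i = (f j).comp (Subalgebra.inclusion (hS h)))
    (T : Subalgebra A B) (hT : T = iSup S) :
    ∃ g : T →ₐ[A] K, ∀ (i : ι) (b : B) (hb : b ∈ S i) (hbT : b ∈ T), g ⟨b, hbT⟩ = f i ⟨b, hb⟩ := by
  refine ⟨Subalgebra.iSupLift S hS.directed_le f (fun i j h => ?_) T hT.le,
    fun i b hb hbT => ?_⟩
  · obtain hij | hji := le_total i j
    · exact hf i j hij
    · ext x
      exact (DFunLike.congr_fun (hf j i hji) (Subalgebra.inclusion h x)).symm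
  · exact Subalgebra.iSupLift_mk (K := S) ⟨b, hb⟩ hbT

end Algebraic

/-! ### Extension of characters -/

section Normed

variable {A B : Type*} [NormedCommRing A] [NormedCommRing B] [Algebra A B]
  {U : Set A[X]} [LinearOrder U] [WellFoundedLT U] {E : StandardExtension A B U}

namespace StandardExtension

/-- A contractive character of `A_α` extends to a contractive character of `B_α` taking at `ξ_α`
any prescribed root of the image of `α`. Here and below a character of `A` is encoded as an
`A`-algebra structure on `ℂ`, so that its extensions are `A`-algebra homomorphisms. -/
theorem IsNormed.exists_extend_sub [Nontrivial A] (hE : E.IsNormed) [Algebra A ℂ] {α : U}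
    (hα : (α : A[X]).Monic) (g : lower E.sub α →ₐ[A] ℂ) (hg : ∀ a, ‖g a‖ ≤ ‖a‖) {z : ℂ}
    (hz : (α : A[X]).eval₂ (algebraMap A ℂ) z = 0) :
    ∃ f : E.sub α →ₐ[A] ℂ, (∀ b, ‖f b‖ ≤ ‖b‖) ∧
      f ⟨E.root α, E.root_mem_sub α⟩ = z ∧
      ∀ a, f (Subalgebra.inclusion (lower_le E.mono α) a) = g a := by
  obtain ⟨t, ht, hiso⟩ := hE.2 α
  have hz' : (lowerPoly E.sub α).eval₂ (g : lower E.sub α →+* ℂ) z = 0 := by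
    rw [lowerPoly_eval₂, hz]
  have : Nontrivial B := E.injective.nontrivial
  have hmon : (lowerPoly E.sub α).Monic := hα.map _
  have hdeg : (lowerPoly E.sub α).natDegree ≠ 0 := by
    rw [lowerPoly, hα.natDegree_map]
    exact E.natDegree_ne_zero hα
  have hzt : ‖z‖ ≤ t := norm_le_of_isParameter ht hmon hdeg (g : lower E.sub α →+* ℂ) hg hz'
  have hlow : ∀ a, AdjoinRoot.lift (g : lower E.sub α →+* ℂ) z hz'
      (E.iso α (Subalgebra.inclusion (lower_le E.mono α) a)) = g a := fun a => by
    rw [E.iso_lower, AdjoinRoot.lift_of, AlgHom.coe_toRingHom]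
  refine ⟨{ (AdjoinRoot.lift (g : lower E.sub α →+* ℂ) z hz').comp (E.iso α : E.sub α →+* _) with
      commutes' := fun a => ?_ }, fun b => ?_, ?_, hlow⟩
  · exact (hlow (algebraMap A _ a)).trans (g.commutes a)
  · exact (norm_lift_le_quotNorm (g : lower E.sub α →+* ℂ) hg hzt hz' (E.iso α b)).trans_eq
      (hiso b)
  · change AdjoinRoot.lift (g : lower E.sub α →+* ℂ) z hz' (E.iso α _) = z
    rw [E.iso_root, AdjoinRoot.lift_root]

/-- Transfinite construction of a character of `B_α`. The prescribed values at all the roots in `B_α`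
determine it, so that the characters obtained at earlier stages are compatible. -/
theorem IsNormed.exists_character_sub [Nontrivial A] (hE : E.IsNormed)
    (hmonic : ∀ α ∈ U, α.Monic) [Algebra A ℂ] (hA : ∀ a : A, ‖algebraMap A ℂ a‖ ≤ ‖a‖)
    {z : U → ℂ} (hz : ∀ α : U, (α : A[X]).eval₂ (algebraMap A ℂ) (z α) = 0) (α : U) :
    ∃ f : E.sub α →ₐ[A] ℂ, (∀ b, ‖f b‖ ≤ ‖b‖) ∧
      ∀ β, ∀ hβ : β ≤ α, f ⟨E.root β, E.root_mem_sub_of_le hβ⟩ = z β := by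
  induction α using WellFoundedLT.induction with
  | ind α ih =>
    obtain ⟨g, hg, hgr⟩ : ∃ g : lower E.sub α →ₐ[A] ℂ, (∀ a, ‖g a‖ ≤ ‖a‖) ∧
        ∀ β, ∀ hβ : β < α, ∀ hm : E.root β ∈ lower E.sub α, g ⟨E.root β, hm⟩ = z β := by
      by_cases hα : IsMin α
      -- At the least element `A_α` is the image of `A`; otherwise it is the union of the earlier `B_β`.
      · have hbot := lower_of_isMin E.sub hα
        have hmem : ∀ a : lower E.sub α, ∃ r : A, algebraMap A (lower E.sub α) r = a := by
          rintro ⟨a, ha⟩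
          obtain ⟨r, hr⟩ := Algebra.mem_bot.1 (hbot ▸ ha)
          exact ⟨r, Subtype.ext hr⟩
        refine ⟨(Algebra.ofId A ℂ).comp ((Algebra.botEquivOfInjective E.injective).toAlgHom.comp
          (Subalgebra.inclusion hbot.le)), fun a => ?_,
          fun β hβ => absurd hβ hα.not_lt⟩
        obtain ⟨r, rfl⟩ := hmem a
        rw [AlgHom.commutes]
        exact (hA r).trans_eq (hE.1 r).symm
      · obtain ⟨β₀, hβ₀⟩ := not_isMin_iff.1 hα
        have : Nonempty (Set.Iio α) := ⟨⟨β₀, hβ₀⟩⟩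
        choose f hf hfr using fun β : Set.Iio α => ih β β.2
        obtain ⟨g, hg⟩ := exists_glue (S := fun β : Set.Iio α => E.sub β)
          (fun _ _ h => E.mono h) f
          (fun β γ h => eq_comp_inclusion h (hfr β) (hfr γ)) (lower E.sub α) rfl
        refine ⟨g, fun ⟨a, ha⟩ => ?_, fun β hβ hm => ?_⟩
        · have ha' : a ∈ ⋃ β : Set.Iio α, (E.sub β : Set B) :=
            coe_lower_of_not_isMin E.mono hα ▸ ha
          obtain ⟨β, hβ⟩ := Set.mem_iUnion.1 ha'
          rw [hg β a hβ]
          exact hf β ⟨a, hβ⟩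
        · rw [hg ⟨β, hβ⟩ _ (E.root_mem_sub β)]
          exact hfr ⟨β, hβ⟩ β le_rfl
    obtain ⟨f, hf, hfα, hfl⟩ := hE.exists_extend_sub (hmonic α α.2) g hg (hz α)
    refine ⟨f, hf, fun β hβ => ?_⟩
    obtain rfl | hlt := hβ.eq_or_lt
    · exact hfα
    · have hm : E.root β ∈ lower E.sub α :=
        le_iSup (fun γ : Set.Iio α => E.sub γ) ⟨β, hlt⟩ (E.root_mem_sub β)
      exact (hfl ⟨_, hm⟩).trans (hgr β hlt hm)

theorem IsNormed.exists_algHom [Nontrivial A] (hE : E.IsNormed) (hne : U.Nonempty)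
    (hmonic : ∀ α ∈ U, α.Monic) [Algebra A ℂ] (hA : ∀ a : A, ‖algebraMap A ℂ a‖ ≤ ‖a‖)
    {z : U → ℂ} (hz : ∀ α : U, (α : A[X]).eval₂ (algebraMap A ℂ) (z α) = 0) :
    ∃ f : B →ₐ[A] ℂ, (∀ b, ‖f b‖ ≤ ‖b‖) ∧ ∀ α, f (E.root α) = z α := by
  have : Nonempty U := hne.to_subtype
  choose f hf hfr using hE.exists_character_sub hmonic hA hz
  have htop : (⊤ : Subalgebra A B) = iSup E.sub :=
    (eq_top_iff.2 fun b _ => by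
      obtain ⟨α, hα⟩ := E.exists_mem_sub b
      exact le_iSup E.sub α hα).symm
  obtain ⟨g, hg⟩ := exists_glue E.mono f
    (fun β γ h => eq_comp_inclusion h (hfr β) (hfr γ)) ⊤ htop
  refine ⟨g.comp Subalgebra.topEquiv.symm.toAlgHom, fun b => ?_, fun α => ?_⟩
  · obtain ⟨α, hα⟩ := E.exists_mem_sub b
    exact (congrArg norm (hg α b hα trivial)).trans_le (hf α ⟨b, hα⟩)
  · exact (hg α _ (E.root_mem_sub α) trivial).trans (hfr α α le_rfl)

/-- The image of `α` under a character of `A` has a root. -/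
theorem exists_eval_eq_zero [Nontrivial A] [NormedAlgebra ℂ A] (E : StandardExtension A B U)
    (hmonic : ∀ α ∈ U, α.Monic) (h : characterSpace ℂ A) (α : U) :
    ∃ z : ℂ, ((α : A[X]).map (CharacterSpace.toAlgHom h : A →+* ℂ)).eval z = 0 := by
  refine IsAlgClosed.exists_root _ fun h0 => E.natDegree_ne_zero (hmonic α α.2) ?_
  -- The image of a monic polynomial has the same degree.
  rw [← (hmonic α α.2).natDegree_map (CharacterSpace.toAlgHom h : A →+* ℂ)]
  exact natDegree_eq_zero_iff_degree_le_zero.2 h0.le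

/-- Every point of `rootSet U` comes from a character of `B`. -/
theorem IsNormed.exists_character [NormOneClass A] [NormedAlgebra ℂ A] [NormedAlgebra ℂ B]
    [IsScalarTower ℂ A B] (hE : E.IsNormed) (hne : U.Nonempty) (hmonic : ∀ α ∈ U, α.Monic)
    (h : characterSpace ℂ A) (z : U → ℂ) (hz : (h, z) ∈ rootSet U) :
    ∃ H : characterSpace ℂ B, (∀ a, H (algebraMap A B a) = h a) ∧ ∀ α, H (E.root α) = z α := by
  have : Nontrivial A := NormOneClass.nontrivial (G := A)
  let : Algebra A ℂ := (CharacterSpace.toAlgHom h : A →+* ℂ).toAlgebra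
  have : IsScalarTower ℂ A ℂ := .of_algebraMap_eq fun c =>
    ((CharacterSpace.toAlgHom h).commutes c).symm
  obtain ⟨f, hf, hfr⟩ := hE.exists_algHom hne hmonic (norm_character_apply_le h)
    (z := z) fun α => by
      rw [eval₂_eq_eval_map]
      exact hz α
  exact ⟨characterOfContractive (f.restrictScalars ℂ) hf, f.commutes, hfr⟩

/-! ### The space of characters -/

/-- A map into `Ω(B)` is continuous if its values on `A` and at the roots are. -/
theorem continuous_of_root [NormedAlgebra ℂ B] {X : Type*} [TopologicalSpace X]
    {F : X → characterSpace ℂ B}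
    (hA : ∀ a, Continuous fun x => F x (algebraMap A B a))
    (hr : ∀ α, Continuous fun x => F x (E.root α)) : Continuous F := by
  refine continuous_into_characterSpace fun b => ?_
  have hb : b ∈ Algebra.adjoin A (Set.range E.root) := E.adjoin_range_root ▸ Algebra.mem_top
  induction hb using Algebra.adjoin_induction with
  | mem x hx => obtain ⟨α, rfl⟩ := hx; exact hr α
  | algebraMap r => exact hA r
  | add x y _ _ hx hy => simp only [map_add]; exact hx.add hy
  | mul x y _ _ hx hy => simp only [map_mul]; exact hx.mul hy

variable [NormedAlgebra ℂ A] [NormedAlgebra ℂ B] [IsScalarTower ℂ A B]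

theorem IsNormed.mem_rootSet (hE : E.IsNormed) (H : characterSpace ℂ B) :
    (E.restrictBase hE H, fun α => H (E.root α)) ∈ rootSet U := by
  intro α
  have h1 := congrArg (CharacterSpace.toAlgHom H : B →+* ℂ) (E.aeval_root_eq_zero α)
  rw [map_zero, aeval_def, hom_eval₂] at h1
  rw [eval_map]
  exact h1

theorem IsNormed.character_ext (hE : E.IsNormed) {H H' : characterSpace ℂ B}
    (h : E.restrictBase hE H = E.restrictBase hE H') (hr : ∀ α, H (E.root α) = H' (E.root α)) :
    H = H' := by
  refine DFunLike.ext _ _ fun b => ?_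
  have hb : b ∈ Algebra.adjoin A (Set.range E.root) := E.adjoin_range_root ▸ Algebra.mem_top
  induction hb using Algebra.adjoin_induction with
  | mem x hx => obtain ⟨α, rfl⟩ := hx; exact hr α
  | algebraMap r => exact DFunLike.congr_fun h r
  | add x y _ _ hx hy => rw [map_add, map_add, hx, hy]
  | mul x y _ _ hx hy => rw [map_mul, map_mul, hx, hy]

/-- The map `Ω(B) → rootSet U`, `H ↦ (H|_A, (H(ξ_α))_α)`. -/
noncomputable def IsNormed.toRootSet (hE : E.IsNormed) (H : characterSpace ℂ B) : rootSet U :=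
  ⟨(E.restrictBase hE H, fun α => H (E.root α)), hE.mem_rootSet H⟩

theorem IsNormed.continuous_toRootSet (hE : E.IsNormed) : Continuous hE.toRootSet :=
  ((continuous_into_characterSpace fun a => continuous_character_eval (algebraMap A B a)).prodMk
    (continuous_pi fun α => continuous_character_eval (E.root α))).subtype_mk _

theorem IsNormed.bijective_toRootSet [NormOneClass A] (hE : E.IsNormed) (hne : U.Nonempty)
    (hmonic : ∀ α ∈ U, α.Monic) : Function.Bijective hE.toRootSet := by
  refine ⟨fun H H' h => ?_, fun ⟨⟨h, z⟩, hz⟩ => ?_⟩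
  · have h' := congrArg Subtype.val h
    exact hE.character_ext (congrArg Prod.fst h') (congrFun (congrArg Prod.snd h'))
  · obtain ⟨H, hH, hHr⟩ := hE.exists_character hne hmonic h z hz
    exact ⟨H, Subtype.ext (Prod.ext (DFunLike.ext _ _ hH) (funext hHr))⟩

/-- The homeomorphism `Ω(B) ≃ₜ rootSet U`, `H ↦ (H|_A, (H(ξ_α))_α)`. -/
noncomputable def IsNormed.homeomorph [NormOneClass A] (hE : E.IsNormed) (hne : U.Nonempty)
    (hmonic : ∀ α ∈ U, α.Monic) : characterSpace ℂ B ≃ₜ rootSet U where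
  toEquiv := Equiv.ofBijective _ (hE.bijective_toRootSet hne hmonic)
  continuous_toFun := hE.continuous_toRootSet
  continuous_invFun := by
    have hinv := (Equiv.ofBijective _ (hE.bijective_toRootSet hne hmonic)).apply_symm_apply
    refine continuous_of_root (E := E) (fun a => ?_) fun α => ?_
    · refine ((continuous_character_eval a).comp
        (continuous_fst.comp continuous_subtype_val)).congr fun p => ?_
      exact (DFunLike.congr_fun (congrArg (fun q => q.1.1) (hinv p)) a).symm
    · refine ((continuous_apply α).comp
        (continuous_snd.comp continuous_subtype_val)).congr fun p => ?_
      exact (congrFun (congrArg (fun q => q.1.2) (hinv p)) α).symm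

theorem IsNormed.surjective_restrictBase [NormOneClass A] (hE : E.IsNormed) (hne : U.Nonempty)
    (hmonic : ∀ α ∈ U, α.Monic) : Function.Surjective (E.restrictBase hE) := by
  have : Nontrivial A := NormOneClass.nontrivial (G := A)
  intro h
  choose z hz using E.exists_eval_eq_zero hmonic h
  obtain ⟨H, hH, -⟩ := hE.exists_character hne hmonic h z hz
  exact ⟨H, DFunLike.ext _ _ hH⟩

theorem IsNormed.surjective_restrictSub [NormOneClass A] (hE : E.IsNormed) (hne : U.Nonempty)
    (hmonic : ∀ α ∈ U, α.Monic) (α : U) : Function.Surjective (E.restrictSub α) := by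
  have : Nontrivial A := NormOneClass.nontrivial (G := A)
  intro G
  have hι : Continuous (IsScalarTower.toAlgHom ℂ A (E.sub α)) := hE.continuous.subtype_mk _
  let h : characterSpace ℂ A := charComp (IsScalarTower.toAlgHom ℂ A (E.sub α)) hι G
  -- Up to `α` the roots are dictated by `G`; beyond `α` they are arbitrary.
  have hroot : ∀ β : U, ∃ z : ℂ,
      ((β : A[X]).map (CharacterSpace.toAlgHom h : A →+* ℂ)).eval z = 0 ∧
        ∀ hβ : β ≤ α, G ⟨E.root β, E.root_mem_sub_of_le hβ⟩ = z := fun β => by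
    by_cases hβ : β ≤ α
    · refine ⟨G ⟨E.root β, E.root_mem_sub_of_le hβ⟩, ?_, fun _ => rfl⟩
      have h0 : aeval (⟨E.root β, E.root_mem_sub_of_le hβ⟩ : E.sub α) (β : A[X]) = 0 := by
        refine Subtype.val_injective ?_
        change (E.sub α).val _ = 0
        rw [← aeval_algHom_apply]
        exact E.aeval_root_eq_zero β
      have h1 := congrArg (CharacterSpace.toAlgHom G : E.sub α →+* ℂ) h0
      rw [map_zero, aeval_def, hom_eval₂] at h1
      rw [eval_map]
      exact h1
    · obtain ⟨z, hz⟩ := E.exists_eval_eq_zero hmonic h β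
      exact ⟨z, hz, fun hβ' => absurd hβ' hβ⟩
  choose z hz hzG using hroot
  obtain ⟨H, hH, hHr⟩ := hE.exists_character hne hmonic h z hz
  refine ⟨H, ?_⟩
  let : Algebra A ℂ := (CharacterSpace.toAlgHom h : A →+* ℂ).toAlgebra
  let f : E.sub α →ₐ[A] ℂ :=
    { (CharacterSpace.toAlgHom (E.restrictSub α H) : E.sub α →+* ℂ) with commutes' := hH }
  let g : E.sub α →ₐ[A] ℂ :=
    { (CharacterSpace.toAlgHom G : E.sub α →+* ℂ) with commutes' := fun _ => rfl }
  have hfg : f = g := E.sub_algHom_ext fun β hβ => (hHr β).trans (hzG β hβ).symm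
  exact DFunLike.ext _ _ fun b => DFunLike.congr_fun hfg b

end StandardExtension

end Normed

end ArensHoffman

theorem theorem5p6 {A B : Type*}
    [NormedCommRing A] [NormedAlgebra ℂ A] [NormOneClass A]
    [NormedCommRing B] [NormedAlgebra ℂ B] [Algebra A B] [IsScalarTower ℂ A B]
    (U : Set A[X]) (hne : U.Nonempty) (hmonic : ∀ α ∈ U, α.Monic)
    [LinearOrder U] [WellFoundedLT U]
    (E : ArensHoffman.StandardExtension A B U) (hE : E.IsNormed) :
    (∃ e : characterSpace ℂ B ≃ₜ ArensHoffman.rootSet U,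
      ∀ H : characterSpace ℂ B,
        (e H : characterSpace ℂ A × (U → ℂ)) = (E.restrictBase hE H, fun α => H (E.root α))) ∧
    Function.Surjective (E.restrictBase hE) ∧
    ∀ α : U, Function.Surjective (E.restrictSub α) :=
  ⟨⟨hE.homeomorph hne hmonic, fun _ => rfl⟩, hE.surjective_restrictBase hne hmonic,
    hE.surjective_restrictSub hne hmonic⟩
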